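/- Let $n\ge 0$ be an integer. For $\kappa\in\mathbb{Z}_{\ge 0}^n$ and a polynomial $p\in\mathbb{R}[y_1,\dots,y_n,z_1,\dots,z_n]$ let $C_p(\kappa,\kappa)$ denote the coefficient of $\prod_{i=1}^n y_i^{\kappa_i}z_i^{\kappa_i}$ in $p$. Call $p$ multilinear if every monomial occurring in it is square-free, and bistable if the polynomial $p(y_1,\dots,y_n,-z_1,\dots,-z_n)$ is real stable, that is, if it is either the zero polynomial or has no zero in $\mathbb{C}^{2n}$ all of whose coordinates have positive imaginary part. For vectors $x,a$ write $x^a:=\prod_{i=1}^n x_i^{a_i}$, with the convention that a factor with exponent $0$ equals $1$; products and quotients of vectors are taken coordinatewise. **Theorem.** Let $p(y_1,\dots,y_n,z_1,\dots,z_n)$ be a bistable multilinear polynomial with nonnegative real coefficients and let $\alpha\in\mathbb{R}^n$ have nonnegative coordinates. Then $$\sum_{\kappa\in\{0,1\}^n} C_p(\kappa,\kappa)\;\ge\;(1-\alpha)^{1-\alpha}\,\inf_{y,z>0}\frac{p(y,z)}{(yz/\alpha)^{\alpha}},$$ where $(1-\alpha)^{1-\alpha}=\prod_{i=1}^n(1-\alpha_i)^{1-\alpha_i}$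 and the infimum is over all $y,z\in\mathbb{R}^n$ with positive coordinates. If $\alpha_i>1$ for some $i$, so that $(1-\alpha)^{1-\alpha}$ is not defined, the inequality holds with this factor replaced by an arbitrary real number. -/

import Mathlib

/-- A complex polynomial is stable if it has no zero all of whose coordinates have positive
imaginary part; by convention the zero polynomial is also stable. -/
def IsStable {σ : Type*} (p : MvPolynomial σ ℂ) : Prop :=
  p = 0 ∨ ∀ w : σ → ℂ, (∀ i, 0 < (w i).im) → MvPolynomial.eval w p ≠ 0

/-- A polynomial with real coefficients is real stable if it is stable. -/
def IsRealStable {σ : Type*} (p : MvPolynomial σ ℝ) : Prop :=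
  IsStable (MvPolynomial.map (algebraMap ℝ ℂ) p)

/-- A polynomial in the variables `y₁, …, yₙ` (`Sum.inl i`) and `z₁, …, zₙ` (`Sum.inr i`). -/
abbrev BiPolynomial (n : ℕ) : Type := MvPolynomial (Fin n ⊕ Fin n) ℝ

/-- The polynomial `p(y₁, …, yₙ, -z₁, …, -zₙ)`. -/
noncomputable def negSecond {n : ℕ} (p : BiPolynomial n) : BiPolynomial n :=
  MvPolynomial.bind₁
    (Sum.elim (fun i => MvPolynomial.X (Sum.inl i)) (fun i => -MvPolynomial.X (Sum.inr i))) p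

/-- `p(y, z)` is bistable if `p(y, -z)` is real stable. -/
def IsBistable {n : ℕ} (p : BiPolynomial n) : Prop :=
  IsRealStable (negSecond p)

/-- Every monomial that occurs in `p` is square-free. -/
def IsMultilinear {σ : Type*} (p : MvPolynomial σ ℝ) : Prop :=
  ∀ m ∈ p.support, ∀ i, m i ≤ 1

/-- All coefficients of `p` are nonnegative. -/
def HasNonnegCoeffs {σ : Type*} (p : MvPolynomial σ ℝ) : Prop :=
  ∀ m, 0 ≤ p.coeff m

/-- The value `p(y, z)`. -/
noncomputable def evalPair {n : ℕ} (p : BiPolynomial n) (y z : Fin n → ℝ) : ℝ :=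
  MvPolynomial.eval (Sum.elim y z) p

/-- `C_p(κ, μ)`, the coefficient of `∏ i, yᵢ ^ κᵢ * ∏ i, zᵢ ^ μᵢ` in `p`. -/
noncomputable def coeffPair {n : ℕ} (p : BiPolynomial n) (κ μ : Fin n → ℕ) : ℝ :=
  p.coeff (Finsupp.equivFunOnFinite.symm (Sum.elim κ μ))

/-- `x ^ a = ∏ i, xᵢ ^ aᵢ` for vectors `x`, `a` (real powers, `0 ^ 0 = 1`). -/
noncomputable def vecPow {n : ℕ} (x a : Fin n → ℝ) : ℝ :=
  ∏ i, x i ^ a i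

/-- The set of values of `p(y, z) / (y z / α) ^ α` over all coordinatewise positive `y`, `z`;
its infimum is the one in the theorem. Where `αᵢ = 0` the factor `(yᵢ zᵢ / αᵢ) ^ αᵢ` is `1` (as `0 ^ 0 = 1`). For `p` with nonnegative
coefficients the set is nonempty and bounded below by `0`, see `capSet_nonempty` and
`capSet_bddBelow`. -/
def capSet {n : ℕ} (p : BiPolynomial n) (α : Fin n → ℝ) : Set ℝ :=
  {r | ∃ y z : Fin n → ℝ, (∀ i, 0 < y i) ∧ (∀ i, 0 < z i) ∧
    r = evalPair p y z / vecPow (fun i => y i * z i / α i) α}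

theorem capSet_nonempty {n : ℕ} (p : BiPolynomial n) (α : Fin n → ℝ) : (capSet p α).Nonempty :=
  ⟨_, fun _ => 1, fun _ => 1, fun _ => one_pos, fun _ => one_pos, rfl⟩

theorem capSet_bddBelow {n : ℕ} (p : BiPolynomial n) (hp : HasNonnegCoeffs p) (α : Fin n → ℝ)
    (hα : ∀ i, 0 ≤ α i) : BddBelow (capSet p α) := by
  refine ⟨0, ?_⟩
  rintro r ⟨y, z, hy, hz, rfl⟩
  apply div_nonneg
  · unfold evalPair
    rw [MvPolynomial.eval_eq']
    refine Finset.sum_nonneg fun m _ => mul_nonneg (hp m) (Finset.prod_nonneg fun i _ => ?_)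
    rcases i with i | i
    · exact pow_nonneg (hy i).le _
    · exact pow_nonneg (hz i).le _
  · exact Finset.prod_nonneg fun i _ =>
      Real.rpow_nonneg (div_nonneg (mul_pos (hy i) (hz i)).le (hα i)) _

/-! The proof is by induction on `n`, removing one pair of variables at a time. Write `p = a + b y₁
+ c z₁ + d y₁ z₁`, with `a, b, c, d` polynomials in the other variables, and pass to `a + d`, which
has the same diagonal coefficient sum. Three facts carry the step. First, `a + d` is again bistable,
by a Lieb–Sokal argument (`nowhereOrEverywhereZeroOn_sub`). Second, bistability forces `b c ≤ a d`
at every real point (`IsBistableCoeff.mul_le_mul`). Third, for numbers with `b c ≤ a d`, a lower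
bound `M (y z / α) ^ α` for the bilinear form gives `(1 - α) ^ (1 - α) * M ≤ a + d` (`capacity_le`).
Applied pointwise in the remaining variables, the last two bound the capacity of `a + d` from below,
and each step contributes one factor.

If some `αⱼ > 1`, the infimum is `0`: along `yⱼ = zⱼ = t → ∞` a multilinear polynomial grows at most
like `t ^ 2`, the denominator like `t ^ (2 αⱼ)`. -/

open Filter Topology

/-! ### Stability as a zero dichotomy for analytic functions -/

/-- `f` vanishes nowhere on `U` or everywhere on `U`. -/
def NowhereOrEverywhereZeroOn {E : Type*} (U : Set E) (f : E → ℂ) : Prop :=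
  (∀ u ∈ U, f u ≠ 0) ∨ ∀ u ∈ U, f u = 0

/-- A Hurwitz-type replacement for letting `y → 0`. At a zero of `A` the quotient `A / B` is
analytic. Either it is locally constant, so `A` vanishes identically, or it is open and takes some
value `-it` with `t > 0`, which gives a forbidden zero at `y = it`. -/
theorem nowhereOrEverywhereZeroOn_of_add_mul_ne_zero {E : Type*} [NormedAddCommGroup E]
    [NormedSpace ℂ E] {U : Set E} (hUo : IsOpen U) (hU : IsPreconnected U) {A B : E → ℂ}
    (hA : AnalyticOnNhd ℂ A U) (hB : AnalyticOnNhd ℂ B U)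
    (h : ∀ u ∈ U, ∀ y : ℂ, 0 < y.im → A u + y * B u ≠ 0) :
    NowhereOrEverywhereZeroOn U A := by
  by_cases h0 : ∀ u ∈ U, A u ≠ 0
  · exact Or.inl h0
  push Not at h0
  obtain ⟨u, hu, hAu⟩ := h0
  have hBu : B u ≠ 0 := fun hB0 => h u hu Complex.I (by simp) (by simp [hAu, hB0])
  right
  have hg : AnalyticAt ℂ (fun v => A v / B v) u := (hA u hu).div (hB u hu) hBu
  have hBne : ∀ᶠ v in 𝓝 u, B v ≠ 0 := (hB u hu).continuousAt.eventually_ne hBu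
  rcases hg.eventually_constant_or_nhds_le_map_nhds with hc | hm
  · refine hA.eqOn_zero_of_preconnected_of_eventuallyEq_zero hU hu ?_
    filter_upwards [hc, hBne] with v hv hv'
    simpa [hAu, hv'] using hv
  · exfalso
    have hUo := hUo.mem_nhds hu
    have h1 : {w : ℂ | ∃ v, v ∈ U ∧ B v ≠ 0 ∧ A v / B v = w} ∈ 𝓝 (A u / B u) := by
      apply hm
      rw [mem_map]
      filter_upwards [hUo, hBne] with v hv hv'
      exact ⟨v, hv, hv', rfl⟩
    rw [hAu, zero_div] at h1
    have h2 : Tendsto (fun t : ℝ => -((t : ℂ) * Complex.I)) (𝓝[>] 0) (𝓝 0) := by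
      refine Tendsto.mono_left ?_ nhdsWithin_le_nhds
      have : Continuous fun t : ℝ => -((t : ℂ) * Complex.I) := by fun_prop
      simpa using this.tendsto 0
    obtain ⟨t, ⟨v, hv, hv', hw⟩, ht⟩ := ((h2.eventually h1).and self_mem_nhdsWithin).exists
    refine h v hv ((t : ℂ) * Complex.I) (by simpa using ht) ?_
    rw [div_eq_iff hv'] at hw
    rw [hw]; ring

theorem neg_inv_im_pos {y : ℂ} (hy : 0 < y.im) : 0 < (-y⁻¹).im := by
  have : 0 < Complex.normSq y := Complex.normSq_pos.2 fun h => by simp [h] at hy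
  rw [Complex.neg_im, Complex.inv_im, neg_div, neg_neg]
  positivity

/-- The substitution `y ↦ -1/y` preserves the upper half plane and exchanges the two coefficients.
-/
theorem nowhereOrEverywhereZeroOn_leading {E : Type*} [NormedAddCommGroup E]
    [NormedSpace ℂ E] {U : Set E} (hUo : IsOpen U) (hU : IsPreconnected U) {A B : E → ℂ}
    (hA : AnalyticOnNhd ℂ A U) (hB : AnalyticOnNhd ℂ B U)
    (h : ∀ u ∈ U, ∀ y : ℂ, 0 < y.im → A u + y * B u ≠ 0) :
    NowhereOrEverywhereZeroOn U B := by
  refine nowhereOrEverywhereZeroOn_of_add_mul_ne_zero (B := fun u => -A u) hUo hU hB hA.neg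
    fun u hu y hy h0 => h u hu _ (neg_inv_im_pos hy) ?_
  have hy0 : y ≠ 0 := fun h => by simp [h] at hy
  field_simp
  linear_combination -h0

/-- A form of the Lieb–Sokal lemma: `1 - ∂_y ∂_z` followed by `y = z = 0` preserves stability. -/
theorem nowhereOrEverywhereZeroOn_sub {E : Type*} [NormedAddCommGroup E]
    [NormedSpace ℂ E] {U : Set E} (hUo : IsOpen U) (hU : IsPreconnected U) {A B C D : E → ℂ}
    (hA : AnalyticOnNhd ℂ A U) (hB : AnalyticOnNhd ℂ B U)
    (hC : AnalyticOnNhd ℂ C U) (hD : AnalyticOnNhd ℂ D U)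
    (h : ∀ u ∈ U, ∀ y z : ℂ, 0 < y.im → 0 < z.im →
      A u + y * B u + z * (C u + y * D u) ≠ 0) :
    NowhereOrEverywhereZeroOn U (fun u => A u - D u) := by
  have hHo : IsOpen {y : ℂ | 0 < y.im} := isOpen_lt continuous_const Complex.continuous_im
  have hHc : IsPreconnected {y : ℂ | 0 < y.im} := (convex_halfSpace_im_gt 0).isPreconnected
  have hVo := hUo.prod hHo
  have hV := hU.prod hHc
  have lift : ∀ {f g : E → ℂ}, AnalyticOnNhd ℂ f U → AnalyticOnNhd ℂ g U →
      AnalyticOnNhd ℂ (fun v : E × ℂ => f v.1 + v.2 * g v.1) (U ×ˢ {y : ℂ | 0 < y.im}) := by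
    intro f g hf hg v hv
    have h1 : AnalyticAt ℂ (fun v : E × ℂ => f v.1) v := (hf v.1 hv.1).comp analyticAt_fst
    have h2 : AnalyticAt ℂ (fun v : E × ℂ => g v.1) v := (hg v.1 hv.1).comp analyticAt_fst
    exact h1.add (analyticAt_snd.mul h2)
  have hP := nowhereOrEverywhereZeroOn_of_add_mul_ne_zero hVo hV (lift hA hB) (lift hC hD)
    fun v hv z hz => h v.1 hv.1 v.2 z hv.2 hz
  have hQ := nowhereOrEverywhereZeroOn_leading hVo hV (lift hA hB) (lift hC hD)
    fun v hv z hz => h v.1 hv.1 v.2 z hv.2 hz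
  have zero_of : ∀ {f g : E → ℂ}, (∀ v ∈ U ×ˢ {y : ℂ | 0 < y.im}, f v.1 + v.2 * g v.1 = 0) →
      ∀ u ∈ U, f u = 0 ∧ g u = 0 := by
    intro f g hfg u hu
    have h1 := hfg (u, Complex.I) ⟨hu, by simp⟩
    have h2 := hfg (u, 2 * Complex.I) ⟨hu, by simp⟩
    simp only at h1 h2
    have hf : f u = 0 := by linear_combination 2 * h1 - h2
    refine ⟨hf, ?_⟩
    rw [hf, zero_add] at h1
    exact (mul_eq_zero.1 h1).resolve_left Complex.I_ne_zero
  have hD' : NowhereOrEverywhereZeroOn U D := by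
    rcases hQ with hQ | hQ
    · exact nowhereOrEverywhereZeroOn_leading hUo hU hC hD fun u hu y hy => hQ (u, y) ⟨hu, hy⟩
    · exact Or.inr fun u hu => (zero_of hQ u hu).2
  rcases hD' with hD' | hD'
  · have hQ : ∀ u ∈ U, ∀ y : ℂ, 0 < y.im → C u + y * D u ≠ 0 := by
      rcases hQ with hQ | hQ
      · exact fun u hu y hy => hQ (u, y) ⟨hu, hy⟩
      · exact fun u hu => absurd (zero_of hQ u hu).2 (hD' u hu)
    refine nowhereOrEverywhereZeroOn_of_add_mul_ne_zero hUo hU (hA.sub hD) hB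
      fun u hu y hy h0 => ?_
    have hDu := hD' u hu
    -- Otherwise the root `-C/D` of `C + y D` would lie in the upper half plane.
    have him : 0 ≤ (C u / D u).im := by
      by_contra! hneg
      refine hQ u hu (-(C u / D u)) (by simpa using hneg) ?_
      field_simp
      ring
    have hw : 0 < (C u / D u + y).im := by rw [Complex.add_im]; linarith
    have hw0 : C u / D u + y ≠ 0 := fun h => by simp [h] at hw
    -- With `z = -1 / (C/D + y)` the term `z (C + y D)` equals `-D`, so the form becomes `(A - D) +
    -- y B`.
    refine h u hu y _ hy (neg_inv_im_pos hw) ?_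
    have e : C u + y * D u = (C u / D u + y) * D u := by field_simp
    rw [e, neg_mul, inv_mul_cancel_left₀ hw0]
    linear_combination h0
  · have hA' : NowhereOrEverywhereZeroOn U A := by
      rcases hP with hP | hP
      · exact nowhereOrEverywhereZeroOn_of_add_mul_ne_zero hUo hU hA hB
          fun u hu y hy => hP (u, y) ⟨hu, hy⟩
      · exact Or.inr fun u hu => (zero_of hP u hu).1
    rcases hA' with hA' | hA'
    · exact Or.inl fun u hu => by simpa [hD' u hu] using hA' u hu
    · exact Or.inr fun u hu => by simp [hD' u hu, hA' u hu]

/-! ### The inequality for a single pair of variables -/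

theorem le_of_forall_pos_le_quadratic {M a b d : ℝ}
    (h : ∀ t : ℝ, 0 < t → M ≤ a + b * t + d * t ^ 2) : M ≤ a := by
  have ht : Tendsto (fun t : ℝ => a + b * t + d * t ^ 2) (𝓝[>] 0) (𝓝 a) := by
    refine Tendsto.mono_left ?_ nhdsWithin_le_nhds
    have : Continuous fun t : ℝ => a + b * t + d * t ^ 2 := by fun_prop
    simpa using this.tendsto 0
  exact ge_of_tendsto ht (by filter_upwards [self_mem_nhdsWithin] with t ht using h t ht)

theorem capacity_le_of_pos {a b c d α M : ℝ} (ha : 0 < a) (hd : 0 < d) (hb : 0 ≤ b)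
    (hc : 0 ≤ c) (h : b * c ≤ a * d) (hα : 0 < α) (hα1 : α < 1)
    (hM : ∀ y z : ℝ, 0 < y → 0 < z →
      M * (y * z / α) ^ α ≤ a + b * y + c * z + d * (y * z)) :
    (1 - α) ^ (1 - α) * M ≤ a + d := by
  have hβ : 0 < 1 - α := by linarith
  -- Enlarging `b, c` until `b' c' = a d` makes the form factor as `a (1 + b' y / a) (1 + c' z /
  -- a)`. The test point below makes both factors equal to `1 / (1 - α)`.
  obtain ⟨b', c', hb', hc', hbb, hcc, hbc⟩ :
      ∃ b' c' : ℝ, 0 < b' ∧ 0 < c' ∧ b ≤ b' ∧ c ≤ c' ∧ b' * c' = a * d := by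
    rcases hb.eq_or_lt with rfl | hb
    · exact ⟨a * d / (c + 1), c + 1, by positivity, by positivity, by positivity, by linarith,
        by field_simp⟩
    · exact ⟨b, a * d / b, hb, by positivity, le_rfl, by rw [le_div_iff₀ hb]; linarith,
        by field_simp⟩
  have hy : 0 < α * a / ((1 - α) * b') := by positivity
  have hz : 0 < α * a / ((1 - α) * c') := by positivity
  have key := hM _ _ hy hz
  have e1 : α * a / ((1 - α) * b') * (α * a / ((1 - α) * c')) = α ^ 2 * a / ((1 - α) ^ 2 * d) := by
    have : α * a / ((1 - α) * b') * (α * a / ((1 - α) * c')) =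
      α ^ 2 * a ^ 2 / ((1 - α) ^ 2 * (b' * c')) := by field_simp
    rw [this, hbc]; field_simp
  have e2 : a + b * (α * a / ((1 - α) * b')) + c * (α * a / ((1 - α) * c')) +
      d * (α ^ 2 * a / ((1 - α) ^ 2 * d)) ≤ a / (1 - α) ^ 2 := by
    have h1 : b * (α * a / ((1 - α) * b')) ≤ b' * (α * a / ((1 - α) * b')) := by gcongr
    have h2 : c * (α * a / ((1 - α) * c')) ≤ c' * (α * a / ((1 - α) * c')) := by gcongr
    have h3 : a + b' * (α * a / ((1 - α) * b')) + c' * (α * a / ((1 - α) * c')) +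
      d * (α ^ 2 * a / ((1 - α) ^ 2 * d)) = a / (1 - α) ^ 2 := by field_simp; ring
    linarith
  rw [e1] at key
  have e3 : α ^ 2 * a / ((1 - α) ^ 2 * d) / α = (a / (1 - α)) * (1 - α)⁻¹ * (d / α)⁻¹ := by
    field_simp
  have hA : 0 < a / (1 - α) := by positivity
  have hB : 0 < d / α := by positivity
  -- The bound at the test point reduces to this weighted AM-GM with weights `1 - α` and `α`.
  have amgm : (a / (1 - α)) ^ (1 - α) * (d / α) ^ α ≤ a + d := by
    have := Real.geom_mean_le_arith_mean2_weighted hβ.le hα.le hA.le hB.le (by ring)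
    have e : (1 - α) * (a / (1 - α)) + α * (d / α) = a + d := by field_simp
    linarith
  rw [e3, Real.mul_rpow (by positivity) (by positivity), Real.mul_rpow hA.le (by positivity),
    Real.inv_rpow hβ.le, Real.inv_rpow hB.le] at key
  have pA := Real.rpow_pos_of_pos hA α
  have pB := Real.rpow_pos_of_pos hB α
  have pβ := Real.rpow_pos_of_pos hβ α
  refine le_trans ?_ amgm
  rw [Real.rpow_sub hβ, Real.rpow_sub hA, Real.rpow_one, Real.rpow_one]
  have key2 := key.trans e2
  calc (1 - α) / (1 - α) ^ α * M
      = (1 - α) * (d / α) ^ α / (a / (1 - α)) ^ α *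
        (M * ((a / (1 - α)) ^ α * ((1 - α) ^ α)⁻¹ * ((d / α) ^ α)⁻¹)) := by
        generalize (d / α) ^ α = u at *
        generalize (a / (1 - α)) ^ α = v at *
        generalize (1 - α) ^ α = w at *
        field_simp
    _ ≤ (1 - α) * (d / α) ^ α / (a / (1 - α)) ^ α * (a / (1 - α) ^ 2) := by gcongr
    _ = a / (1 - α) / (a / (1 - α)) ^ α * (d / α) ^ α := by
        generalize (d / α) ^ α = u at *
        generalize (a / (1 - α)) ^ α = v at *
        field_simp

/-- Degenerate cases by limits: `y = z → 0` for `α = 0`, `y = z → ∞` for `α = 1`, and otherwise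
raising `a` and `d` by `ε / 2`. -/
theorem capacity_le {a b c d α M : ℝ} (ha : 0 ≤ a) (hd : 0 ≤ d) (hb : 0 ≤ b)
    (hc : 0 ≤ c) (h : b * c ≤ a * d) (hα : 0 ≤ α) (hα1 : α ≤ 1)
    (hM : ∀ y z : ℝ, 0 < y → 0 < z →
      M * (y * z / α) ^ α ≤ a + b * y + c * z + d * (y * z)) :
    (1 - α) ^ (1 - α) * M ≤ a + d := by
  rcases hα.eq_or_lt with rfl | hα
  · have : M ≤ a := le_of_forall_pos_le_quadratic (b := b + c) (d := d) fun t ht => by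
      have := hM t t ht ht
      simp only [Real.rpow_zero, mul_one] at this
      linarith
    simp only [sub_zero, Real.one_rpow, one_mul]
    linarith
  rcases hα1.eq_or_lt with rfl | hα1
  · have : M ≤ d := le_of_forall_pos_le_quadratic (b := b + c) (d := a) fun t ht => by
      have := hM t⁻¹ t⁻¹ (by positivity) (by positivity)
      simp only [Real.rpow_one, div_one] at this
      have h2 := mul_le_mul_of_nonneg_right this (sq_nonneg t)
      have e1 : M * (t⁻¹ * t⁻¹) * t ^ 2 = M := by field_simp
      have e2 : (a + b * t⁻¹ + c * t⁻¹ + d * (t⁻¹ * t⁻¹)) * t ^ 2 =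
        d + (b + c) * t + a * t ^ 2 := by field_simp; ring
      linarith
    simp only [sub_self, Real.rpow_zero, one_mul]
    linarith
  refine le_of_forall_pos_le_add fun ε hε => ?_
  have := capacity_le_of_pos (a := a + ε / 2) (d := d + ε / 2) (M := M) (by positivity)
    (by positivity) hb hc (by nlinarith) hα hα1 fun y z hy hz => (hM y z hy hz).trans (by
      have := mul_pos hy hz
      nlinarith)
  linarith

/-! ### Multilinear polynomials as coefficient arrays, and bistability of their slices -/

section MultiAffine

variable {n : ℕ} {K : Type*} [CommRing K] [Algebra ℝ K]

/-- The multilinear polynomial with coefficients `c`, as a function of `y` and `z`. -/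
def multiAffine (c : (Fin n → Fin 2) → (Fin n → Fin 2) → ℝ) (y z : Fin n → K) : K :=
  ∑ κ, ∑ μ, algebraMap ℝ K (c κ μ) * ((∏ i, y i ^ (κ i : ℕ)) * ∏ i, z i ^ (μ i : ℕ))

/-- The part of degrees `a`, `b` in the first variables `y`, `z`. -/
def slice (c : (Fin (n + 1) → Fin 2) → (Fin (n + 1) → Fin 2) → ℝ) (a b : Fin 2) :
    (Fin n → Fin 2) → (Fin n → Fin 2) → ℝ :=
  fun κ μ => c (Fin.cons a κ) (Fin.cons b μ)

theorem sum_cons_fin_two {M : Type*} [AddCommMonoid M] (f : (Fin (n + 1) → Fin 2) → M) :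
    ∑ κ, f κ = ∑ κ, f (Fin.cons 0 κ) + ∑ κ, f (Fin.cons 1 κ) := by
  rw [← (Fin.consEquiv fun _ => Fin 2).sum_comp, Fintype.sum_prod_type, Fin.sum_univ_two]
  rfl

theorem multiAffine_cons (c : (Fin (n + 1) → Fin 2) → (Fin (n + 1) → Fin 2) → ℝ) (y₀ z₀ : K)
    (y z : Fin n → K) :
    multiAffine c (Fin.cons y₀ y : Fin (n + 1) → K) (Fin.cons z₀ z : Fin (n + 1) → K) =
      multiAffine (slice c 0 0) y z + y₀ * multiAffine (slice c 1 0) y z +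
        z₀ * (multiAffine (slice c 0 1) y z + y₀ * multiAffine (slice c 1 1) y z) := by
  simp only [multiAffine, sum_cons_fin_two, Fin.prod_univ_succ, Fin.cons_zero, Fin.cons_succ,
    slice, Finset.mul_sum, ← Finset.sum_add_distrib]
  refine Finset.sum_congr rfl fun κ _ => Finset.sum_congr rfl fun μ _ => ?_
  simp only [Fin.val_zero, Fin.val_one, pow_zero, pow_one]
  ring

theorem multiAffine_add (c d : (Fin n → Fin 2) → (Fin n → Fin 2) → ℝ) (y z : Fin n → K) :
    multiAffine (c + d) y z = multiAffine c y z + multiAffine d y z := by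
  simp only [multiAffine, ← Finset.sum_add_distrib, Pi.add_apply, map_add, add_mul]

theorem multiAffine_ofReal (c : (Fin n → Fin 2) → (Fin n → Fin 2) → ℝ) (y z : Fin n → ℝ) :
    multiAffine c (fun i => (y i : ℂ)) (fun i => (z i : ℂ)) = (multiAffine c y z : ℝ) := by
  simp [multiAffine]

theorem multiAffine_nonneg {c : (Fin n → Fin 2) → (Fin n → Fin 2) → ℝ}
    (hc : ∀ κ μ, 0 ≤ c κ μ) {y z : Fin n → ℝ} (hy : ∀ i, 0 < y i) (hz : ∀ i, 0 < z i) :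
    0 ≤ multiAffine c y z :=
  Finset.sum_nonneg fun κ _ => Finset.sum_nonneg fun μ _ => mul_nonneg (hc κ μ)
    (mul_nonneg (Finset.prod_nonneg fun i _ => pow_nonneg (hy i).le _)
      (Finset.prod_nonneg fun i _ => pow_nonneg (hz i).le _))

theorem analyticAt_multiAffine_neg (c : (Fin n → Fin 2) → (Fin n → Fin 2) → ℝ)
    (u : (Fin n → ℂ) × (Fin n → ℂ)) :
    AnalyticAt ℂ (fun u : (Fin n → ℂ) × (Fin n → ℂ) => multiAffine c u.1 (-u.2)) u := by
  have h1 : ∀ i, AnalyticAt ℂ (fun u : (Fin n → ℂ) × (Fin n → ℂ) => u.1 i) u := fun i =>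
    ((ContinuousLinearMap.proj (R := ℂ) (φ := fun _ : Fin n => ℂ) i).comp
      (ContinuousLinearMap.fst ℂ _ _)).analyticAt u
  have h2 : ∀ i, AnalyticAt ℂ (fun u : (Fin n → ℂ) × (Fin n → ℂ) => u.2 i) u := fun i =>
    ((ContinuousLinearMap.proj (R := ℂ) (φ := fun _ : Fin n => ℂ) i).comp
      (ContinuousLinearMap.snd ℂ _ _)).analyticAt u
  unfold multiAffine
  refine Finset.analyticAt_fun_sum _ fun κ _ => Finset.analyticAt_fun_sum _ fun μ _ =>
    analyticAt_const.mul (.mul (Finset.analyticAt_fun_prod _ fun i _ => (h1 i).pow _)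
      (Finset.analyticAt_fun_prod _ fun i _ => (h2 i).neg.pow _))

theorem continuous_multiAffine (c : (Fin n → Fin 2) → (Fin n → Fin 2) → ℝ) :
    Continuous fun u : (Fin n → ℂ) × (Fin n → ℂ) => multiAffine c u.1 u.2 := by
  unfold multiAffine
  fun_prop

/-- Pairs of vectors all of whose coordinates lie in the open upper half plane. -/
def upperHalfPairs (n : ℕ) : Set ((Fin n → ℂ) × (Fin n → ℂ)) :=
  (Set.univ.pi fun _ => {y | 0 < y.im}) ×ˢ (Set.univ.pi fun _ => {y | 0 < y.im})

theorem isOpen_upperHalfPairs : IsOpen (upperHalfPairs n) :=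
  have h := isOpen_set_pi (s := fun _ : Fin n => {y : ℂ | 0 < y.im}) Set.finite_univ
    fun _ _ => isOpen_lt continuous_const Complex.continuous_im
  h.prod h

theorem isPreconnected_upperHalfPairs : IsPreconnected (upperHalfPairs n) :=
  have h := isPreconnected_univ_pi (s := fun _ : Fin n => {y : ℂ | 0 < y.im})
    fun _ => (convex_halfSpace_im_gt 0).isPreconnected
  h.prod h

/-- Bistability of the multilinear polynomial with coefficients `c`. -/
def IsBistableCoeff (c : (Fin n → Fin 2) → (Fin n → Fin 2) → ℝ) : Prop :=
  NowhereOrEverywhereZeroOn (upperHalfPairs n) fun u => multiAffine c u.1 (-u.2)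

theorem cons_mem_upperHalfPairs {u : (Fin n → ℂ) × (Fin n → ℂ)} (hu : u ∈ upperHalfPairs n)
    {y z : ℂ} (hy : 0 < y.im) (hz : 0 < z.im) :
    ((Fin.cons y u.1 : Fin (n + 1) → ℂ), (Fin.cons z u.2 : Fin (n + 1) → ℂ)) ∈
      upperHalfPairs (n + 1) := by
  constructor <;> intro i _ <;> refine Fin.cases ?_ (fun j => ?_) i
  · simpa using hy
  · simpa using hu.1 j trivial
  · simpa using hz
  · simpa using hu.2 j trivial

theorem multiAffine_cons_neg (c : (Fin (n + 1) → Fin 2) → (Fin (n + 1) → Fin 2) → ℝ) (y₀ z₀ : K)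
    (y z : Fin n → K) :
    multiAffine c (Fin.cons y₀ y : Fin (n + 1) → K) (-(Fin.cons z₀ z : Fin (n + 1) → K)) =
      multiAffine (slice c 0 0) y (-z) + y₀ * multiAffine (slice c 1 0) y (-z) +
        z₀ * (-multiAffine (slice c 0 1) y (-z) + y₀ * -multiAffine (slice c 1 1) y (-z)) := by
  have : -(Fin.cons z₀ z : Fin (n + 1) → K) = Fin.cons (-z₀) (-z) := by
    ext i; refine Fin.cases ?_ (fun j => ?_) i <;> simp
  rw [this, multiAffine_cons]
  ring

theorem coeffs_eq_zero_of_forall_upperHalf {A B C D : ℂ}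
    (h : ∀ y z : ℂ, 0 < y.im → 0 < z.im → A + y * B + z * (C + y * D) = 0) :
    A = 0 ∧ B = 0 ∧ C = 0 ∧ D = 0 := by
  have aux : ∀ {S T : ℂ}, (∀ y : ℂ, 0 < y.im → S + y * T = 0) → S = 0 ∧ T = 0 := by
    intro S T h
    have h1 := h Complex.I (by simp)
    have h2 := h (2 * Complex.I) (by simp)
    have hS : S = 0 := by linear_combination 2 * h1 - h2
    rw [hS, zero_add] at h1
    exact ⟨hS, (mul_eq_zero.1 h1).resolve_left Complex.I_ne_zero⟩
  have h' : ∀ y : ℂ, 0 < y.im → A + y * B = 0 ∧ C + y * D = 0 :=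
    fun y hy => aux fun z hz => h y z hy hz
  obtain ⟨hA, hB⟩ := aux fun y hy => (h' y hy).1
  obtain ⟨hC, hD⟩ := aux fun y hy => (h' y hy).2
  exact ⟨hA, hB, hC, hD⟩

theorem IsBistableCoeff.cases {c : (Fin (n + 1) → Fin 2) → (Fin (n + 1) → Fin 2) → ℝ}
    (hc : IsBistableCoeff c) :
    (∀ u ∈ upperHalfPairs n, ∀ y z : ℂ, 0 < y.im → 0 < z.im →
      multiAffine (slice c 0 0) u.1 (-u.2) + y * multiAffine (slice c 1 0) u.1 (-u.2) +
        z * (-multiAffine (slice c 0 1) u.1 (-u.2) +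
          y * -multiAffine (slice c 1 1) u.1 (-u.2)) ≠ 0) ∨
    ∀ u ∈ upperHalfPairs n, ∀ a b, multiAffine (slice c a b) u.1 (-u.2) = 0 := by
  refine hc.imp (fun h u hu y z hy hz h0 => ?_) fun h u hu => ?_
  · exact h ((Fin.cons y u.1 : Fin (n + 1) → ℂ), (Fin.cons z u.2 : Fin (n + 1) → ℂ))
      (cons_mem_upperHalfPairs hu hy hz)
      ((multiAffine_cons_neg c y z u.1 u.2).trans h0)
  · obtain ⟨h00, h10, h01, h11⟩ := coeffs_eq_zero_of_forall_upperHalf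
      (A := multiAffine (slice c 0 0) u.1 (-u.2)) (B := multiAffine (slice c 1 0) u.1 (-u.2))
      (C := -multiAffine (slice c 0 1) u.1 (-u.2)) (D := -multiAffine (slice c 1 1) u.1 (-u.2))
      fun y z hy hz => (multiAffine_cons_neg c y z u.1 u.2).symm.trans
        (h ((Fin.cons y u.1 : Fin (n + 1) → ℂ), (Fin.cons z u.2 : Fin (n + 1) → ℂ))
          (cons_mem_upperHalfPairs hu hy hz))
    simpa [Fin.forall_fin_two, h00, h10] using And.intro (neg_eq_zero.1 h01) (neg_eq_zero.1 h11)

/-- The sign change in `z` turns the coefficient of `y₀ z₀` into its negative, so the difference `A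
- D` of the Lieb–Sokal step becomes a sum. -/
theorem IsBistableCoeff.slice_add {c : (Fin (n + 1) → Fin 2) → (Fin (n + 1) → Fin 2) → ℝ}
    (hc : IsBistableCoeff c) : IsBistableCoeff (slice c 0 0 + slice c 1 1) := by
  rcases hc.cases with h | h
  · have := nowhereOrEverywhereZeroOn_sub isOpen_upperHalfPairs isPreconnected_upperHalfPairs
      (fun u _ => analyticAt_multiAffine_neg (slice c 0 0) u)
      (fun u _ => analyticAt_multiAffine_neg (slice c 1 0) u)
      (fun u _ => (analyticAt_multiAffine_neg (slice c 0 1) u).neg)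
      (fun u _ => (analyticAt_multiAffine_neg (slice c 1 1) u).neg) h
    simpa [IsBistableCoeff, multiAffine_add] using this
  · exact Or.inr fun u hu => by simp [multiAffine_add, h u hu]

/-- If the inequality failed at a real point, solving for `z₀` with `y₀ = i` would give a root of
positive imaginary part. By continuity it survives moving the real point slightly into the upper
half plane, against bistability. -/
theorem IsBistableCoeff.mul_le_mul {c : (Fin (n + 1) → Fin 2) → (Fin (n + 1) → Fin 2) → ℝ}
    (hc : IsBistableCoeff c) (y z : Fin n → ℝ) :
    multiAffine (slice c 1 0) y z * multiAffine (slice c 0 1) y z ≤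
      multiAffine (slice c 0 0) y z * multiAffine (slice c 1 1) y z := by
  by_contra! hlt
  let w : ℝ → (Fin n → ℂ) × (Fin n → ℂ) := fun ε =>
    (fun i => (y i : ℂ) + ε * Complex.I, fun i => -(z i : ℂ) + ε * Complex.I)
  have hw : ∀ ε : ℝ, 0 < ε → w ε ∈ upperHalfPairs n := fun ε hε => by
    constructor <;> intro i _ <;> simpa [w] using hε
  let f : Fin 2 → Fin 2 → ℝ → ℂ := fun a b ε => multiAffine (slice c a b) (w ε).1 (-(w ε).2)
  have hf : ∀ a b, Continuous (f a b) := fun a b => by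
    refine (continuous_multiAffine (slice c a b)).comp (f := fun ε => ((w ε).1, -(w ε).2)) ?_
    simp only [w]
    fun_prop
  have hf0 : ∀ a b, f a b 0 = (multiAffine (slice c a b) y z : ℝ) := fun a b => by
    rw [← multiAffine_ofReal]
    simp only [f, w]
    congr 1
    · ext i; simp
    · ext i; simp
  set a := multiAffine (slice c 0 0) y z
  set b := multiAffine (slice c 1 0) y z
  set c' := multiAffine (slice c 0 1) y z
  set d := multiAffine (slice c 1 1) y z
  rcases hc.cases with h | h
  · let Q : ℝ → ℂ := fun ε => f 0 1 ε + Complex.I * f 1 1 ε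
    let P : ℝ → ℂ := fun ε => f 0 0 ε + Complex.I * f 1 0 ε
    have hQc : Continuous Q := (hf 0 1).add (continuous_const.mul (hf 1 1))
    have hPc : Continuous P := (hf 0 0).add (continuous_const.mul (hf 1 0))
    have hQn : 0 < Complex.normSq (Q 0) := by
      have : Complex.normSq (Q 0) = c' ^ 2 + d ^ 2 := by
        simp [Q, hf0, Complex.normSq_apply, c', d]; ring
      rw [this]
      by_contra! h0
      have h1 : c' = 0 := by nlinarith [sq_nonneg c', sq_nonneg d]
      have h2 : d = 0 := by nlinarith [sq_nonneg c', sq_nonneg d]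
      simp [h1, h2] at hlt
    have hQ0 : Q 0 ≠ 0 := Complex.normSq_pos.1 hQn
    have him : 0 < (P 0 / Q 0).im := by
      rw [Complex.div_im]
      have : (P 0).im * (Q 0).re - (P 0).re * (Q 0).im = b * c' - a * d := by
        simp [P, Q, hf0, a, b, c', d]
      rw [← sub_div, this]
      exact div_pos (by linarith) hQn
    have hc0 : ContinuousAt (fun ε => (P ε / Q ε).im) 0 :=
      Complex.continuous_im.continuousAt.comp (hPc.continuousAt.div hQc.continuousAt hQ0)
    have ev : ∀ᶠ ε in 𝓝[>] (0 : ℝ), 0 < (P ε / Q ε).im ∧ Q ε ≠ 0 :=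
      nhdsWithin_le_nhds ((hc0.eventually_const_lt him).and (hQc.continuousAt.eventually_ne hQ0))
    obtain ⟨ε, ⟨h1, h2⟩, hε⟩ := (ev.and self_mem_nhdsWithin).exists
    refine h (w ε) (hw ε hε) Complex.I (P ε / Q ε) (by simp) h1 ?_
    change P ε + P ε / Q ε * (-f 0 1 ε + Complex.I * -f 1 1 ε) = 0
    have : -f 0 1 ε + Complex.I * -f 1 1 ε = - Q ε := by simp only [Q]; ring
    rw [this]
    field_simp
    ring
  · have hz : ∀ a b, f a b 0 = 0 := fun a b => by
      have h1 : Tendsto (f a b) (𝓝[>] 0) (𝓝 (f a b 0)) :=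
        ((hf a b).tendsto 0).mono_left nhdsWithin_le_nhds
      refine tendsto_nhds_unique h1 (tendsto_const_nhds.congr' ?_)
      filter_upwards [self_mem_nhdsWithin] with ε hε using (h _ (hw ε hε) a b).symm
    have hb : b = 0 := by simpa [hf0] using hz 1 0
    have ha : a = 0 := by simpa [hf0] using hz 0 0
    simp [ha, hb] at hlt

end MultiAffine

/-! ### The induction on the number of variable pairs -/

theorem vecPow_succ {n : ℕ} (x a : Fin (n + 1) → ℝ) :
    vecPow x a = x 0 ^ a 0 * vecPow (fun i => x i.succ) (fun i => a i.succ) :=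
  Fin.prod_univ_succ _

theorem IsBistableCoeff.mul_le_sum_diag {n : ℕ} {c : (Fin n → Fin 2) → (Fin n → Fin 2) → ℝ}
    (hc : IsBistableCoeff c) (hc0 : ∀ κ μ, 0 ≤ c κ μ) {α : Fin n → ℝ} (hα : ∀ i, 0 ≤ α i)
    (hα1 : ∀ i, α i ≤ 1) {M : ℝ}
    (hM : ∀ y z : Fin n → ℝ, (∀ i, 0 < y i) → (∀ i, 0 < z i) →
      M * vecPow (fun i => y i * z i / α i) α ≤ multiAffine c y z) :
    vecPow (fun i => 1 - α i) (fun i => 1 - α i) * M ≤ ∑ κ, c κ κ := by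
  induction n generalizing M with
  | zero =>
    have := hM 1 1 (fun i => i.elim0) fun i => i.elim0
    simpa [vecPow, multiAffine] using this
  | succ n ih =>
    have := ih (c := slice c 0 0 + slice c 1 1) (α := fun i => α i.succ)
      (M := (1 - α 0) ^ (1 - α 0) * M) hc.slice_add
      (fun κ μ => add_nonneg (hc0 _ _) (hc0 _ _)) (fun i => hα _) (fun i => hα1 _)
      fun y z hy hz => by
        rw [multiAffine_add, mul_assoc]
        refine capacity_le (b := multiAffine (slice c 1 0) y z)
          (c := multiAffine (slice c 0 1) y z) (multiAffine_nonneg (fun _ _ => hc0 _ _) hy hz)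
          (multiAffine_nonneg (fun _ _ => hc0 _ _) hy hz)
          (multiAffine_nonneg (fun _ _ => hc0 _ _) hy hz)
          (multiAffine_nonneg (fun _ _ => hc0 _ _) hy hz) (hc.mul_le_mul y z) (hα 0) (hα1 0)
          fun y₀ z₀ hy₀ hz₀ => ?_
        have h := hM (Fin.cons y₀ y) (Fin.cons z₀ z) (Fin.cases (by simpa) (by simpa))
          (Fin.cases (by simpa) (by simpa))
        rw [vecPow_succ, multiAffine_cons] at h
        simp only [Fin.cons_zero, Fin.cons_succ] at h
        linarith
    rw [vecPow_succ, sum_cons_fin_two]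
    simp only [Pi.add_apply, slice, Finset.sum_add_distrib] at this
    linarith

/-! ### From `MvPolynomial` to coefficient arrays -/

theorem sumElim_fin_two_injective {n : ℕ} : Function.Injective
    fun κ : (Fin n → Fin 2) × (Fin n → Fin 2) => (Finsupp.equivFunOnFinite.symm
      (Sum.elim (fun i => (κ.1 i : ℕ)) (fun i => (κ.2 i : ℕ))) : Fin n ⊕ Fin n →₀ ℕ) := by
  intro κ μ h
  have h' := Finsupp.equivFunOnFinite.symm.injective h
  refine Prod.ext (funext fun i => Fin.ext ?_) (funext fun i => Fin.ext ?_)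
  · exact congrFun h' (Sum.inl i)
  · exact congrFun h' (Sum.inr i)

theorem aeval_eq_multiAffine {n : ℕ} {K : Type*} [CommRing K] [Algebra ℝ K]
    {p : BiPolynomial n} (hp : IsMultilinear p) (y z : Fin n → K) :
    MvPolynomial.aeval (Sum.elim y z) p =
      multiAffine (fun κ μ => coeffPair p (fun i => (κ i : ℕ)) (fun i => (μ i : ℕ))) y z := by
  classical
  rw [MvPolynomial.aeval_def, MvPolynomial.eval₂_eq', multiAffine, ← Fintype.sum_prod_type']
  set e := fun κ : (Fin n → Fin 2) × (Fin n → Fin 2) => (Finsupp.equivFunOnFinite.symm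
      (Sum.elim (fun i => (κ.1 i : ℕ)) (fun i => (κ.2 i : ℕ))) : Fin n ⊕ Fin n →₀ ℕ) with he
  have hsub : p.support ⊆ Finset.univ.image e := by
    intro m hm
    refine Finset.mem_image.2 ⟨(fun i => ⟨m (Sum.inl i), Nat.lt_succ_of_le (hp m hm _)⟩,
      fun i => ⟨m (Sum.inr i), Nat.lt_succ_of_le (hp m hm _)⟩), Finset.mem_univ _, ?_⟩
    ext i
    rcases i with i | i <;> simp [he]
  rw [Finset.sum_subset hsub fun m _ hm => by
    simp [MvPolynomial.notMem_support_iff.1 hm],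
    Finset.sum_image fun a _ b _ h => sumElim_fin_two_injective h]
  refine Finset.sum_congr rfl fun κ _ => ?_
  simp [coeffPair, Fintype.prod_sum_type]

theorem IsBistable.isBistableCoeff {n : ℕ} {p : BiPolynomial n} (h : IsBistable p)
    (hp : IsMultilinear p) :
    IsBistableCoeff fun κ μ => coeffPair p (fun i => (κ i : ℕ)) (fun i => (μ i : ℕ)) := by
  have key : ∀ u : (Fin n → ℂ) × (Fin n → ℂ),
      MvPolynomial.eval (Sum.elim u.1 u.2) (MvPolynomial.map (algebraMap ℝ ℂ) (negSecond p)) =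
        multiAffine (fun κ μ => coeffPair p (fun i => (κ i : ℕ)) (fun i => (μ i : ℕ)))
          u.1 (-u.2) := by
    intro u
    rw [← aeval_eq_multiAffine hp, MvPolynomial.eval_map, ← MvPolynomial.aeval_def, negSecond,
      MvPolynomial.aeval_bind₁]
    congr 2
    ext i
    rcases i with i | i <;> simp
  refine h.symm.imp (fun h u hu => ?_) fun h u hu => ?_
  · refine (key u).symm.trans_ne ?_
    refine h _ fun i => ?_
    rcases i with i | i
    · exact hu.1 i trivial
    · exact hu.2 i trivial
  · refine (key u).symm.trans ?_
    rw [h, map_zero]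

theorem evalPair_eq_multiAffine {n : ℕ} {p : BiPolynomial n} (hp : IsMultilinear p)
    (y z : Fin n → ℝ) :
    evalPair p y z =
      multiAffine (fun κ μ => coeffPair p (fun i => (κ i : ℕ)) (fun i => (μ i : ℕ))) y z := by
  rw [← aeval_eq_multiAffine hp, evalPair, MvPolynomial.aeval_def, MvPolynomial.eval₂_eq_eval_map]
  simp

/-! ### The capacity when some exponent exceeds one -/

theorem rpow_div_self_pos {x a : ℝ} (hx : 0 < x) (ha : 0 ≤ a) : 0 < (x / a) ^ a := by
  rcases ha.eq_or_lt with rfl | ha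
  · simp
  · positivity

theorem vecPow_div_pos {n : ℕ} {x a : Fin n → ℝ} (hx : ∀ i, 0 < x i) (ha : ∀ i, 0 ≤ a i) :
    0 < vecPow (fun i => x i / a i) a :=
  Finset.prod_pos fun i _ => rpow_div_self_pos (hx i) (ha i)

theorem sInf_capSet_nonneg {n : ℕ} {p : BiPolynomial n} (hp : HasNonnegCoeffs p) {α : Fin n → ℝ}
    (hα : ∀ i, 0 ≤ α i) : 0 ≤ sInf (capSet p α) := by
  refine Real.sInf_nonneg ?_
  rintro r ⟨y, z, hy, hz, rfl⟩
  refine div_nonneg ?_ (vecPow_div_pos (fun i => mul_pos (hy i) (hz i)) hα).le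
  unfold evalPair
  rw [MvPolynomial.eval_eq']
  refine Finset.sum_nonneg fun m _ => mul_nonneg (hp m) (Finset.prod_nonneg fun i _ => ?_)
  rcases i with i | i
  · exact pow_nonneg (hy i).le _
  · exact pow_nonneg (hz i).le _

theorem sInf_capSet_eq_zero {n : ℕ} {p : BiPolynomial n} (hm : IsMultilinear p)
    (hp : HasNonnegCoeffs p) {α : Fin n → ℝ} (hα : ∀ i, 0 ≤ α i) {j : Fin n} (hj : 1 < α j) :
    sInf (capSet p α) = 0 := by
  refine le_antisymm ?_ (sInf_capSet_nonneg hp hα)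
  -- Test points `y = z = v t`; the quotient is at most a constant times `(t * t / αⱼ) ^ (1 - αⱼ)`,
  -- which tends to `0`.
  let v : ℝ → Fin n → ℝ := fun t => Function.update 1 j t
  let K := ∑ m ∈ p.support, p.coeff m
  let W := ∏ i ∈ Finset.univ.erase j, (1 / α i) ^ α i
  have hW : 0 < W := Finset.prod_pos fun i _ => rpow_div_self_pos one_pos (hα i)
  have hvec : ∀ t : ℝ, vecPow (fun i => v t i * v t i / α i) α = (t * t / α j) ^ α j * W := by
    intro t
    rw [vecPow, ← Finset.mul_prod_erase _ _ (Finset.mem_univ j)]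
    congr 1
    · simp [v]
    · refine Finset.prod_congr rfl fun i hi => ?_
      simp [v, Function.update_of_ne (Finset.ne_of_mem_erase hi)]
  have hprod : ∀ (e : Fin n → ℕ) (t : ℝ), 1 ≤ t → e j ≤ 1 → ∏ i, v t i ^ e i ≤ t := by
    intro e t ht he
    rw [← Finset.mul_prod_erase _ _ (Finset.mem_univ j), Finset.prod_eq_one, mul_one]
    · simpa [v] using pow_le_pow_right₀ ht he
    · intro i hi
      simp [v, Function.update_of_ne (Finset.ne_of_mem_erase hi)]
  have hvpos : ∀ t : ℝ, 0 < t → ∀ i, 0 < v t i := by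
    intro t ht i
    rcases eq_or_ne i j with rfl | hij
    · simpa [v] using ht
    · simp [v, Function.update_of_ne hij]
  have hev : ∀ t : ℝ, 1 ≤ t → evalPair p (v t) (v t) ≤ K * (t * t) := by
    intro t ht
    rw [evalPair, MvPolynomial.eval_eq', Finset.sum_mul]
    refine Finset.sum_le_sum fun m hmm => mul_le_mul_of_nonneg_left ?_ (hp m)
    rw [Fintype.prod_sum_type]
    simp only [Sum.elim_inl, Sum.elim_inr]
    have h0 := hvpos t (by linarith)
    exact mul_le_mul (hprod _ t ht (hm m hmm _)) (hprod _ t ht (hm m hmm _))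
      (Finset.prod_nonneg fun i _ => (pow_pos (h0 i) _).le) (by linarith)
  have hαj : 0 < α j := by linarith
  have hbound : ∀ t : ℝ, 1 ≤ t →
      sInf (capSet p α) ≤ K * α j / W * (t * t / α j) ^ (-(α j - 1)) := by
    intro t ht
    have ht0 : 0 < t := by linarith
    refine (csInf_le (capSet_bddBelow p hp α hα)
      ⟨v t, v t, hvpos t ht0, hvpos t ht0, rfl⟩).trans ?_
    have hs : 0 < t * t / α j := by positivity
    rw [hvec, div_le_iff₀ (mul_pos (Real.rpow_pos_of_pos hs _) hW)]
    refine (hev t ht).trans_eq ?_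
    rw [neg_sub, Real.rpow_sub hs, Real.rpow_one]
    have := Real.rpow_pos_of_pos hs (α j)
    field_simp
  have hlim : Tendsto (fun t : ℝ => K * α j / W * (t * t / α j) ^ (-(α j - 1))) atTop
      (𝓝 (K * α j / W * 0)) :=
    ((tendsto_rpow_neg_atTop (by linarith)).comp
      ((tendsto_id.atTop_mul_atTop₀ tendsto_id).atTop_div_const hαj)).const_mul _
  rw [mul_zero] at hlim
  exact ge_of_tendsto hlim (eventually_atTop.2 ⟨1, hbound⟩)

theorem mainTheorem3 (n : ℕ) (p : BiPolynomial n) (hbistable : IsBistable p)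
    (hmultilinear : IsMultilinear p) (hnonneg : HasNonnegCoeffs p)
    (α : Fin n → ℝ) (hα : ∀ i, 0 ≤ α i) :
    ((∀ i, α i ≤ 1) →
      vecPow (fun i => 1 - α i) (fun i => 1 - α i) * sInf (capSet p α) ≤
        ∑ κ : Fin n → Fin 2, coeffPair p (fun i => (κ i : ℕ)) (fun i => (κ i : ℕ))) ∧
    ((∃ i, 1 < α i) → ∀ c : ℝ,
      c * sInf (capSet p α) ≤
        ∑ κ : Fin n → Fin 2, coeffPair p (fun i => (κ i : ℕ)) (fun i => (κ i : ℕ))) := by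
  constructor
  · intro hα1
    refine (hbistable.isBistableCoeff hmultilinear).mul_le_sum_diag (fun _ _ => hnonneg _) hα hα1
      fun y z hy hz => ?_
    rw [← evalPair_eq_multiAffine hmultilinear,
      ← le_div_iff₀ (vecPow_div_pos (fun i => mul_pos (hy i) (hz i)) hα)]
    exact csInf_le (capSet_bddBelow p hnonneg α hα) ⟨y, z, hy, hz, rfl⟩
  · rintro ⟨j, hj⟩ c
    rw [sInf_capSet_eq_zero hmultilinear hnonneg hα hj, mul_zero]
    exact Finset.sum_nonneg fun κ _ => hnonneg _
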